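/- Let $\tau(n)$ $(n\ge 1)$ be Ramanujan's tau function, defined by $\Delta(z)=q\prod_{n\ge 1}(1-q^n)^{24}=\sum_{n\ge 1}\tau(n)q^n$, where $q=e^{2\pi i z}$ and $\operatorname{Im} z>0$. Let $\sigma_k(n)=\sum_{d\mid n}d^k$ and $\sigma=\sigma_1$. Then for every integer $n\ge 1$: (i) $\displaystyle \tau(n)=n^4\sigma(n)-24\sum_{m=1}^{n-1}\left(35m^4-52m^3n+18m^2n^2\right)\sigma(m)\sigma(n-m)$; (ii) $\displaystyle \tau(n)=n^4\left(7\sigma(n)-6\sigma_3(n)\right)-168\sum_{m=1}^{n-1}\left(5m^4-4m^3n\right)\sigma(m)\sigma(n-m)$; (iii) $\displaystyle \tau(n)=n^4\sigma_3(n)-168\sum_{m=1}^{n-1}\left(5m^4-8m^3n+3m^2n^2\right)\sigma(m)\sigma(n-m)$; (iv) $\displaystyle \tau(n)=\frac{n^4}{3}\left(7\sigma(n)-4\sigma_3(n)\right)-56\sum_{m=1}^{n-1}\left(15m^4-20m^3n+6m^2n^2\right)\sigma(m)\sigma(n-m)$. -/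

import Mathlib

open scoped ArithmeticFunction.sigma

/-- Ramanujan's tau function: `τ(n)` is the `n`-th coefficient of the `q`-expansion, with
`q = exp (2 π i z)`, of the discriminant `Δ(z) = η(z) ^ 24 = q ∏_{n ≥ 1} (1 - q ^ n) ^ 24`
on the upper half-plane (the product formula is `ModularForm.discriminant_eq_q_prod`). -/
noncomputable def ramanujanTau (n : ℕ) : ℂ :=
  (UpperHalfPlane.qExpansion 1 ModularForm.discriminant).coeff n

/-!
Write `P`, `Q`, `R` for the `q`-expansions of `E₂`, `E₄`, `E₆` and `θ = q d/dq`. The four formulas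
are the coefficients of `qⁿ` in four identities between power series: with `S = ∑ σ(n) qⁿ` and
`T = ∑ σ₃(n) qⁿ`, the sum over `m` of `(a m⁴ + b m³ n + c m² n²) σ(m) σ(n - m)` is the coefficient
of a combination of `θ⁴S · S`, `θ³S · θS` and `(θ²S)²` (substitute `n = m + (n - m)`; lemma
`sum_Ico_quartic_eq`), while `n⁴ σ(n)` and `n⁴ σ₃(n)` come from `θ⁴S` and `θ⁴T`.

Since `P = 1 - 24 S` and `Q = 1 + 240 T`, these identities live in the ring of quasimodular forms
`ℂ[P, Q, R]`. That ring is stable under `θ` by Ramanujan's differential equations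
`12 θP = P² - Q`, `3 θQ = PQ - R`, `2 θR = PR - Q²` (`theta_E2Series`, `theta_E₄`, `theta_E₆`), and
`1728 Δ = Q³ - R²`, so each identity becomes a polynomial identity in `P`, `Q`, `R`
(`qExpansion_discriminant_relations`).

Ramanujan's equations hold because the difference of the two sides is a modular form of level one
and weight `4`, `6` or `8` with vanishing constant term, hence zero by the Sturm bound
(`eq_zero_of_slash_invariant`). For `E₄` and `E₆` the modularity is that of the Serre derivative;
for `E₂` it follows from the quasimodular transformation law, the anomalies of `12 D E₂` and of
`E₂²` cancelling (`slash_D_E2_sub_sq`).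
-/

namespace RamanujanTau

open UpperHalfPlane hiding I
open Complex Derivative EisensteinSeries ModularForm Function PowerSeries
open scoped Manifold MatrixGroups Real

/-! ### Functions with a convergent `q`-expansion -/

/-- `f` is the sum of the power series `p` at `q = exp (2 π i τ)`, for every `τ` in the upper
half-plane. No holomorphy of `f` is assumed. -/
def HasQExpansion (f : ℍ → ℂ) (p : ℂ⟦X⟧) : Prop :=
  ∀ τ : ℍ, HasSum (fun m : ℕ ↦ p.coeff m • Periodic.qParam 1 τ ^ m) (f τ)

/-- The derivation `θ = q d/dq` of the ring of formal power series. -/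
noncomputable def theta : Derivation ℂ ℂ⟦X⟧ ℂ⟦X⟧ :=
  (X : ℂ⟦X⟧) • PowerSeries.derivative ℂ

lemma coeff_theta (p : ℂ⟦X⟧) (n : ℕ) : (theta p).coeff n = n * p.coeff n := by
  cases n with
  | zero => simp [theta]
  | succ n =>
    simp only [theta, Derivation.smul_apply, smul_eq_mul, coeff_succ_X_mul, coeff_derivative]
    push_cast
    ring

namespace HasQExpansion

variable {f g : ℍ → ℂ} {p q : ℂ⟦X⟧}

lemma add (hf : HasQExpansion f p) (hg : HasQExpansion g q) : HasQExpansion (f + g) (p + q) :=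
  fun τ ↦ by simpa [add_mul] using (hf τ).add (hg τ)

lemma smul (c : ℂ) (hf : HasQExpansion f p) : HasQExpansion (c • f) (c • p) :=
  fun τ ↦ by simpa [mul_assoc] using (hf τ).mul_left c

lemma sub (hf : HasQExpansion f p) (hg : HasQExpansion g q) : HasQExpansion (f - g) (p - q) :=
  fun τ ↦ by simpa [sub_mul] using (hf τ).sub (hg τ)

lemma mul (hf : HasQExpansion f p) (hg : HasQExpansion g q) : HasQExpansion (f * g) (p * q) := by
  intro τ
  have h1 := (hf τ).summable.norm
  have h2 := (hg τ).summable.norm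
  rw [Pi.mul_apply, ← (hf τ).tsum_eq, ← (hg τ).tsum_eq,
    tsum_mul_tsum_eq_tsum_sum_antidiagonal_of_summable_norm h1 h2]
  convert! (summable_norm_sum_mul_antidiagonal_of_summable_norm h1 h2).of_norm.hasSum using 2 with n
  rw [coeff_mul, Finset.sum_smul]
  refine Finset.sum_congr rfl fun x hx ↦ ?_
  rw [← Finset.HasAntidiagonal.mem_antidiagonal.mp hx, pow_add]
  simp only [smul_eq_mul]
  ring

lemma isBoundedAtImInfty (hf : HasQExpansion f p) : IsBoundedAtImInfty f :=
  isBoundedAtImInfty_of_hasSum_qExpansion one_pos hf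

lemma periodic (hf : HasQExpansion f p) : Periodic (f ∘ ofComplex) (1 : ℝ) := by
  intro w
  by_cases hw : 0 < w.im
  · have hw' : 0 < (w + (1 : ℝ)).im := by simpa using hw
    simp only [comp_apply, ofComplex_apply_of_im_pos hw, ofComplex_apply_of_im_pos hw']
    refine (hf ⟨_, hw'⟩).unique ?_
    have hq : Periodic.qParam 1 (w + (1 : ℝ)) = Periodic.qParam 1 w := by
      simp [Periodic.qParam, mul_add, Complex.exp_add]
    have := hf ⟨w, hw⟩
    simp only [← hq] at this
    exact this
  · have hw' : (w + (1 : ℝ)).im ≤ 0 := by simpa using hw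
    rw [comp_apply, comp_apply, ofComplex_apply_of_im_nonpos hw',
      ofComplex_apply_of_im_nonpos (not_lt.mp hw)]

lemma analyticAt_cuspFunction (hf : HasQExpansion f p) (hd : MDiff f) :
    AnalyticAt ℂ (cuspFunction 1 f) 0 :=
  analyticAt_cuspFunction_zero one_pos hf.periodic hd hf.isBoundedAtImInfty

lemma qExpansion_eq (hf : HasQExpansion f p) (hd : MDiff f) : qExpansion 1 f = p := by
  ext m
  have ha := hf.analyticAt_cuspFunction hd
  have h := (hasFPowerSeriesOnBall_cuspFunction one_pos ha hf).hasFPowerSeriesAt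
  simpa [qExpansion_coeff, div_eq_inv_mul] using congr_arg (FormalMultilinearSeries.coeff · m)
    (ha.hasFPowerSeriesAt.eq_formalMultilinearSeries h)

/-- The normalized derivative `(2 π i)⁻¹ d/dτ` acts on `q`-expansions as `θ`. -/
lemma normalizedDeriv (hf : HasQExpansion f p) (hd : MDiff f) :
    HasQExpansion (normalizedDerivOfComplex f) (theta p) := by
  have hdiff := differentiableOn_cuspFunction_ball one_pos hf.periodic hd hf.isBoundedAtImInfty
  intro τ
  set q := Periodic.qParam 1 (τ : ℂ) with hq
  have hq1 : ‖q‖ < 1 := Periodic.norm_qParam_lt_one one_pos τ.im_pos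
  have hball : q ∈ Metric.ball (0 : ℂ) 1 := by simpa using hq1
  -- `q F'(q)`, for `F` the cusp function of `f`, by the Taylor expansion of `F'` at `0`
  have hsum : HasSum (fun n : ℕ ↦ (theta p).coeff (n + 1) • q ^ (n + 1))
      (q * deriv (cuspFunction 1 f) q) := by
    have := (Complex.hasSum_taylorSeries_on_ball
      (hdiff.deriv Metric.isOpen_ball) hball).mul_left q
    convert! this using 2 with n
    rw [coeff_theta, ← hf.qExpansion_eq hd, qExpansion_coeff, ← iteratedDeriv_succ',
      Nat.factorial_succ]
    have : (n.factorial : ℂ) ≠ 0 := mod_cast n.factorial_ne_zero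
    have : ((n + 1 : ℕ) : ℂ) ≠ 0 := mod_cast n.succ_ne_zero
    simp only [smul_eq_mul, sub_zero, Nat.cast_mul]
    field_simp
    ring
  have hderiv : normalizedDerivOfComplex f τ = q * deriv (cuspFunction 1 f) q := by
    have hev : f ∘ ofComplex =ᶠ[nhds (τ : ℂ)] fun z ↦ cuspFunction 1 f (Periodic.qParam 1 z) := by
      filter_upwards [isOpen_upperHalfPlaneSet.mem_nhds τ.im_pos] with z hz
      simpa [ofComplex_apply_of_im_pos hz] using
        (eq_cuspFunction (⟨z, hz⟩ : ℍ) one_ne_zero hf.periodic).symm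
    have h1 : HasDerivAt (Periodic.qParam 1) (2 * π * I * q) (τ : ℂ) := by
      have h : HasDerivAt (fun z : ℂ ↦ 2 * π * I * z / (1 : ℝ)) (2 * π * I) (τ : ℂ) := by
        simpa using (hasDerivAt_id (τ : ℂ)).const_mul (2 * π * I)
      exact (mul_comm q (2 * π * I)) ▸ h.cexp
    have h2 := ((hdiff.differentiableAt (Metric.isOpen_ball.mem_nhds hball)).hasDerivAt).comp
      (τ : ℂ) h1
    rw [normalizedDerivOfComplex, hev.deriv_eq]
    erw [h2.deriv]
    field_simp
  rw [hderiv, ← hasSum_nat_add_iff' 1]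
  simpa [theta] using hsum

end HasQExpansion

/-! ### Ramanujan's differential equations -/

lemma hasQExpansion_modularForm {k : ℤ} (f : ModularForm 𝒮ℒ k) :
    HasQExpansion f (qExpansion 1 f) := by
  intro τ
  have : Fact (IsCusp OnePoint.infty 𝒮ℒ) := 
    ⟨Subgroup.isCusp_of_mem_strictPeriods one_pos one_mem_strictPeriods_SL⟩
  simpa only [smul_eq_mul] using ModularForm.hasSum_qExpansion f one_pos one_mem_strictPeriods_SL τ

/-- The `q`-expansion `1 - 24 ∑ σ(n) qⁿ` of the Eisenstein series `E₂`. -/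
noncomputable def E2Series : ℂ⟦X⟧ := .mk fun m ↦ if m = 0 then 1 else -24 * (σ 1 m : ℂ)

lemma hasQExpansion_E2 : HasQExpansion E2 E2Series := fun τ ↦ by
  simpa only [E2Series, coeff_mk, Periodic.qParam, ofReal_one, div_one] using
    hasSum_qExpansion_E2 (z := τ)

/-- A holomorphic function of level one and weight less than `12` whose `q`-expansion has no
constant term is a modular form to which the Sturm bound applies, so its `q`-expansion vanishes. -/
lemma eq_zero_of_slash_invariant {k : ℕ} (hk : k < 12) {f : ℍ → ℂ} {p : ℂ⟦X⟧}
    (hp : HasQExpansion f p) (hd : MDiff f) (hs : ∀ γ : SL(2, ℤ), f ∣[(k : ℤ)] γ = f)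
    (h0 : p.coeff 0 = 0) : p = 0 := by
  let F : ModularForm 𝒮ℒ (k : ℤ) :=
    { toFun := f
      slash_action_eq' := fun _ ⟨γ, hγ⟩ ↦ hγ ▸ hs γ
      holo' := hd
      bdd_at_cusps' {c} hc := by
        rw [Subgroup.IsArithmetic.isCusp_iff_isCusp_SL2Z] at hc
        rw [OnePoint.isBoundedAt_iff_forall_SL2Z hc]
        intro γ _
        rw [hs γ]
        exact hp.isBoundedAtImInfty }
  have hF : qExpansion 1 F = p := hp.qExpansion_eq hd
  have : F = 0 := by
    apply sturm_bound_levelOne_nat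
    rw [hF, Nat.div_eq_of_lt hk]
    refine lt_of_lt_of_le (by norm_num) (PowerSeries.nat_le_order p 1 fun i hi ↦ ?_)
    obtain rfl : i = 0 := by omega
    exact h0
  rw [← hF, this]
  exact qExpansion_zero 1

lemma slash_eq_self {k : ℤ} (f : ModularForm 𝒮ℒ k) (γ : SL(2, ℤ)) : (f : ℍ → ℂ) ∣[k] γ = f := by
  rw [ModularForm.SL_slash]
  exact SlashInvariantForm.slash_action_eqn f _ ⟨γ, rfl⟩

lemma hasDerivAt_D2 (γ : SL(2, ℤ)) (z : ℍ) :
    HasDerivAt (D2 γ ∘ ofComplex) (-(2 * π * I * (γ 1 0 : ℂ) ^ 2 / denom γ z ^ 2)) (z : ℂ) := by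
  have h := (hasDerivAt_denom_zpow (γ : GL (Fin 2) ℝ) (-1) z).const_mul (2 * π * I * (γ 1 0 : ℂ))
  refine (h.congr_of_eventuallyEq ?_).congr_deriv ?_
  · filter_upwards [isOpen_upperHalfPlaneSet.mem_nhds z.im_pos] with w hw
    simp [D2, ofComplex_apply_of_im_pos hw, div_eq_mul_inv]
  · rw [show (-1 - 1 : ℤ) = -2 by norm_num, zpow_neg, zpow_ofNat]
    simp
    ring

/-- `12 D E₂ - E₂²` is modular of weight `4`, although neither `D E₂` nor `E₂²` is. -/
lemma slash_D_E2_sub_sq (γ : SL(2, ℤ)) :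
    ((12 : ℂ) • normalizedDerivOfComplex E2 - E2 * E2) ∣[(4 : ℤ)] γ =
      (12 : ℂ) • normalizedDerivOfComplex E2 - E2 * E2 := by
  set c : ℂ := 1 / (2 * riemannZeta 2) with hc
  have hπ : (π : ℂ) ≠ 0 := mod_cast Real.pi_ne_zero
  have hcval : c = 3 / π ^ 2 := by
    rw [hc, riemannZeta_two]; field_simp; norm_num
  ext z
  have hE := congrFun (E2_slash_action γ) z
  have hD := congrFun (normalizedDerivOfComplex_SL_slash (k := 2) E2_mdifferentiable (γ := γ)) z
  have hD' : normalizedDerivOfComplex (E2 ∣[(2 : ℤ)] γ) z = normalizedDerivOfComplex E2 z +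
      c * (γ 1 0 : ℂ) ^ 2 / denom γ z ^ 2 := by
    have h := (mdifferentiableAt_iff.mp (E2_mdifferentiable z)).hasDerivAt.sub
      ((hasDerivAt_D2 γ z).const_mul c)
    rw [E2_slash_action]
    simp only [normalizedDerivOfComplex]
    rw [show (E2 - c • D2 γ) ∘ ofComplex =
      E2 ∘ ofComplex - fun w ↦ c * (D2 γ ∘ ofComplex) w from rfl, h.deriv]
    field_simp
    ring
  have hsq := congrFun (mul_slash_SL2 2 2 γ E2 E2) z
  rw [sub_eq_add_neg, SlashAction.add_slash, SlashAction.neg_slash, SL_smul_slash]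
  simp only [Pi.add_apply, Pi.neg_apply, Pi.sub_apply, Pi.mul_apply, Pi.smul_apply, smul_eq_mul,
    D2] at *
  rw [show (4 : ℤ) = 2 + 2 by norm_num]
  rw [hE, ← hc] at hD hsq
  rw [hsq]
  rw [hD'] at hD
  have hI : (2 * π * I : ℂ)⁻¹ = -I / (2 * π) := by
    rw [mul_inv, inv_I]; ring
  set J : ℂ := (γ 1 0 : ℂ) / denom γ z with hJ
  rw [mul_div_assoc, ← div_pow, mul_div_assoc, ← hJ, hI, hcval] at hD
  rw [mul_div_assoc, ← hJ, hcval]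
  push_cast at hD
  -- `J` is the anomaly factor `γ₁₀ / (γ₁₀ z + γ₁₁)`; with `c = 3 / π²`
  -- the terms in `J E₂` and in `J²` both cancel
  have hres (x y : ℂ) : 12 * (y + 3 / π ^ 2 * J ^ 2 + 2 * (-I / (2 * π)) * J *
      (x - 3 / π ^ 2 * (2 * π * I * J))) - (x - 3 / π ^ 2 * (2 * π * I * J)) ^ 2 =
      12 * y - x * x := by
    field_simp
    ring_nf
    simp only [I_sq]
    ring
  norm_num at hD ⊢
  linear_combination hres (E2 z) (normalizedDerivOfComplex E2 z) - 12 * hD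

lemma mdiff_modularForm {k : ℤ} (f : ModularForm 𝒮ℒ k) : MDiff (f : ℍ → ℂ) := f.holo'

lemma theta_E2Series : 12 * theta E2Series = E2Series ^ 2 - qExpansion 1 E₄ := by
  have hp := (((hasQExpansion_E2.normalizedDeriv E2_mdifferentiable).smul 12).sub
    (hasQExpansion_E2.mul hasQExpansion_E2)).add (hasQExpansion_modularForm E₄)
  have := eq_zero_of_slash_invariant (k := 4) (by norm_num) hp ?_ ?_ ?_
  · rw [smul_eq_C_mul] at this
    have h12 : (C (12 : ℂ) : ℂ⟦X⟧) = 12 := map_ofNat _ 12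
    rw [h12] at this
    linear_combination this
  · exact (((normalizedDerivOfComplex_mdifferentiable E2_mdifferentiable).const_smul (12 : ℂ)).sub
      (E2_mdifferentiable.mul E2_mdifferentiable)).add (mdiff_modularForm E₄)
  · intro γ
    have h4 := slash_eq_self E₄ γ
    have h2 := slash_D_E2_sub_sq γ
    push_cast
    rw [SlashAction.add_slash, h4, h2]
  · simp [coeff_theta, E2Series, E_qExpansion_coeff_zero _ ⟨2, rfl⟩, coeff_mul,
      -coeff_zero_eq_constantCoeff]

lemma theta_E₄ : 3 * theta (qExpansion 1 E₄) =
    E2Series * qExpansion 1 E₄ - qExpansion 1 E₆ := by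
  have h4 := hasQExpansion_modularForm E₄
  have h6 := hasQExpansion_modularForm E₆
  have hf : (3 : ℂ) • normalizedDerivOfComplex E₄ - E2 * E₄ + E₆ =
      (3 : ℂ) • serreDerivative ((4 : ℤ) : ℂ) E₄ + E₆ := by
    ext z
    simp only [Pi.add_apply, Pi.sub_apply, Pi.smul_apply, Pi.mul_apply, serreDerivative_apply,
      smul_eq_mul]
    push_cast
    ring
  have hp := (((h4.normalizedDeriv (mdiff_modularForm E₄)).smul 3).sub
    (hasQExpansion_E2.mul h4)).add h6
  have := eq_zero_of_slash_invariant (k := 6) (by norm_num) hp ?_ ?_ ?_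
  · rw [smul_eq_C_mul] at this
    have h3 : (C (3 : ℂ) : ℂ⟦X⟧) = 3 := map_ofNat _ 3
    rw [h3] at this
    linear_combination this
  · rw [hf]
    exact ((serreDerivative_mdifferentiable _ (mdiff_modularForm E₄)).const_smul (3 : ℂ)).add
      (mdiff_modularForm E₆)
  · intro γ
    rw [hf]
    have h1 := serreDerivative_slash_invariant (mdiff_modularForm E₄) (slash_eq_self E₄ γ)
    have h2 := slash_eq_self E₆ γ
    push_cast
    rw [SlashAction.add_slash, h2, SL_smul_slash]
    exact congrArg (fun g ↦ (3 : ℂ) • g + ⇑E₆) h1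
  · simp [coeff_theta, E2Series, E_qExpansion_coeff_zero _ ⟨2, rfl⟩,
      E_qExpansion_coeff_zero _ ⟨3, rfl⟩, coeff_mul, -coeff_zero_eq_constantCoeff]

lemma theta_E₆ : 2 * theta (qExpansion 1 E₆) =
    E2Series * qExpansion 1 E₆ - qExpansion 1 E₄ ^ 2 := by
  have h4 := hasQExpansion_modularForm E₄
  have h6 := hasQExpansion_modularForm E₆
  have hf : (2 : ℂ) • normalizedDerivOfComplex E₆ - E2 * E₆ + ⇑E₄ * ⇑E₄ =
      (2 : ℂ) • serreDerivative ((6 : ℤ) : ℂ) E₆ + ⇑(E₄.mul E₄) := by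
    ext z
    simp only [Pi.add_apply, Pi.sub_apply, Pi.smul_apply, Pi.mul_apply, serreDerivative_apply,
      smul_eq_mul, ModularForm.coe_mul]
    push_cast
    ring
  have hp := (((h6.normalizedDeriv (mdiff_modularForm E₆)).smul 2).sub
    (hasQExpansion_E2.mul h6)).add (h4.mul h4)
  have := eq_zero_of_slash_invariant (k := 8) (by norm_num) hp ?_ ?_ ?_
  · rw [smul_eq_C_mul] at this
    have h2 : (C (2 : ℂ) : ℂ⟦X⟧) = 2 := map_ofNat _ 2
    rw [h2] at this
    linear_combination this
  · rw [hf]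
    exact ((serreDerivative_mdifferentiable _ (mdiff_modularForm E₆)).const_smul (2 : ℂ)).add
      (mdiff_modularForm (E₄.mul E₄))
  · intro γ
    rw [hf]
    have h1 := serreDerivative_slash_invariant (mdiff_modularForm E₆) (slash_eq_self E₆ γ)
    have h2 := slash_eq_self (E₄.mul E₄) γ
    push_cast
    rw [SlashAction.add_slash, SL_smul_slash]
    exact congrArg₂ (fun g h ↦ (2 : ℂ) • g + h) h1 h2
  · simp [coeff_theta, E2Series, E_qExpansion_coeff_zero _ ⟨2, rfl⟩,
      E_qExpansion_coeff_zero _ ⟨3, rfl⟩, coeff_mul, -coeff_zero_eq_constantCoeff]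

lemma qExpansion_discriminant_eq : 1728 * qExpansion 1 discriminant =
    qExpansion 1 E₄ ^ 3 - qExpansion 1 E₆ ^ 2 := by
  have h4 := hasQExpansion_modularForm E₄
  have h6 := hasQExpansion_modularForm E₆
  have hp := ((h4.mul (h4.mul h4)).sub (h6.mul h6)).smul (1728 : ℂ)⁻¹
  have hf : (1728 : ℂ)⁻¹ • (⇑E₄ * (⇑E₄ * ⇑E₄) - ⇑E₆ * ⇑E₆) = discriminant := by
    ext z
    simp only [discriminant_eq_E₄_cube_sub_E₆_sq, Pi.sub_apply, Pi.smul_apply, Pi.mul_apply,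
      smul_eq_mul]
    ring
  rw [hf] at hp
  rw [hp.qExpansion_eq CuspForm.discriminant.holo', smul_eq_C_mul, ← mul_assoc]
  have h : (1728 : ℂ⟦X⟧) * C (1728 : ℂ)⁻¹ = 1 := by
    rw [← map_ofNat (C : ℂ →+* ℂ⟦X⟧) 1728, ← map_mul]
    norm_num
  rw [h]
  ring

/-! ### Iterated derivatives of the Eisenstein series -/

/-- The power series `∑ σ_k(n) qⁿ`; its constant term is `0`, as `σ k 0 = 0`. -/
noncomputable def sigmaSeries (k : ℕ) : ℂ⟦X⟧ := .mk fun m ↦ (σ k m : ℂ)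

lemma E2Series_eq : E2Series = 1 - 24 * sigmaSeries 1 := by
  ext m
  rw [← map_ofNat (C : ℂ →+* ℂ⟦X⟧) 24, map_sub, coeff_C_mul]
  by_cases hm : m = 0 <;> simp [E2Series, sigmaSeries, coeff_one, hm]

lemma E₄_qExpansion_eq : qExpansion 1 E₄ = 1 + 240 * sigmaSeries 3 := by
  ext m
  rw [← map_ofNat (C : ℂ →+* ℂ⟦X⟧) 240, map_add, coeff_C_mul, E_qExpansion_coeff _ ⟨2, rfl⟩]
  by_cases hm : m = 0
  · simp [sigmaSeries, coeff_one, hm]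
  · norm_num [sigmaSeries, coeff_one, hm, show bernoulli 4 = -1 / 30 by decide +kernel]

@[simp]
lemma theta_ofNat (n : ℕ) [n.AtLeastTwo] : theta (ofNat(n) : ℂ⟦X⟧) = 0 := by
  rw [← Nat.cast_ofNat, Derivation.map_natCast]

lemma coeff_ofNat_mul (k n : ℕ) [k.AtLeastTwo] (p : ℂ⟦X⟧) :
    (ofNat(k) * p).coeff n = ofNat(k) * p.coeff n := by
  rw [← map_ofNat (C : ℂ →+* ℂ⟦X⟧) k, coeff_C_mul]

section

local notation "P" => E2Series
local notation "Q" => qExpansion 1 E₄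
local notation "R" => qExpansion 1 E₆

lemma theta_iterate_two_E2Series : 72 * theta (theta P) = P ^ 3 - 3 * P * Q + 2 * R := by
  have h := congrArg theta theta_E2Series
  simp only [pow_succ, pow_zero, one_mul, map_sub, Derivation.leibniz,
    smul_eq_mul, theta_ofNat, mul_zero, add_zero] at h
  linear_combination 6 * h + P * theta_E2Series - 2 * theta_E₄

lemma theta_iterate_three_E2Series : 288 * theta (theta (theta P)) =
    P ^ 4 - 6 * P ^ 2 * Q + 8 * P * R - 3 * Q ^ 2 := by
  have h := congrArg theta theta_iterate_two_E2Series
  simp only [pow_succ, pow_zero, one_mul, map_sub, map_add, Derivation.leibniz,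
    smul_eq_mul, theta_ofNat, mul_zero, add_zero] at h
  linear_combination 4 * h + (P ^ 2 - Q) * theta_E2Series - 4 * P * theta_E₄ + 4 * theta_E₆

lemma theta_iterate_four_E2Series : 864 * theta (theta (theta (theta P))) =
    (P ^ 3 - 3 * P * Q + 2 * R) * (P ^ 2 - Q) - 6 * (P ^ 2 + Q) * (P * Q - R) +
      12 * P * (P * R - Q ^ 2) := by
  have h := congrArg theta theta_iterate_three_E2Series
  simp only [pow_succ, pow_zero, one_mul, map_sub, map_add, Derivation.leibniz,
    smul_eq_mul, theta_ofNat, mul_zero, add_zero] at h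
  linear_combination 3 * h + (P ^ 3 - 3 * P * Q + 2 * R) * theta_E2Series
    - 6 * (P ^ 2 + Q) * theta_E₄ + 12 * P * theta_E₆

lemma theta_iterate_two_E₄ : 36 * theta (theta Q) =
    5 * (P ^ 2 * Q - 2 * P * R + Q ^ 2) := by
  have h := congrArg theta theta_E₄
  simp only [map_sub, Derivation.leibniz,
    smul_eq_mul, theta_ofNat, mul_zero, add_zero] at h
  linear_combination 12 * h + Q * theta_E2Series + 4 * P * theta_E₄ - 6 * theta_E₆

lemma theta_iterate_three_E₄ : 72 * theta (theta (theta Q)) =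
    5 * (P ^ 3 * Q - 3 * P ^ 2 * R + 3 * P * Q ^ 2 - Q * R) := by
  have h := congrArg theta theta_iterate_two_E₄
  simp only [pow_succ, pow_zero, one_mul, map_sub, map_add, Derivation.leibniz,
    smul_eq_mul, theta_ofNat, mul_zero, add_zero] at h
  have h6 : 3 * (72 * theta (theta (theta Q))) =
      3 * (5 * (P ^ 3 * Q - 3 * P ^ 2 * R + 3 * P * Q ^ 2 - Q * R)) := by
    linear_combination 6 * h + 5 * (P * Q - R) * theta_E2Series
      + 10 * (P ^ 2 + 2 * Q) * theta_E₄ - 30 * P * theta_E₆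
  have : CharZero ℂ⟦X⟧ := algebraRat.charZero _
  exact mul_left_cancel₀ (by norm_num) h6

lemma theta_iterate_four_E₄ : 864 * theta (theta (theta (theta Q))) =
    5 * ((3 * P ^ 2 * Q - 6 * P * R + 3 * Q ^ 2) * (P ^ 2 - Q) +
      4 * (P ^ 3 + 6 * P * Q - R) * (P * Q - R) - 6 * (3 * P ^ 2 + Q) * (P * R - Q ^ 2)) := by
  have h := congrArg theta theta_iterate_three_E₄
  simp only [pow_succ, pow_zero, one_mul, map_sub, map_add, Derivation.leibniz,
    smul_eq_mul, theta_ofNat, mul_zero, add_zero] at h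
  linear_combination 12 * h + 5 * (3 * P ^ 2 * Q - 6 * P * R + 3 * Q ^ 2) * theta_E2Series
    + 20 * (P ^ 3 + 6 * P * Q - R) * theta_E₄ - 30 * (3 * P ^ 2 + Q) * theta_E₆

end

lemma theta_iterate_E2Series (a : ℕ) :
    theta^[a + 1] E2Series = -24 * theta^[a + 1] (sigmaSeries 1) := by
  induction a with
  | zero => simp [E2Series_eq]
  | succ a ih => 
    rw [iterate_succ_apply', ih, iterate_succ_apply' _ (a + 1)]
    simp

lemma theta_iterate_E₄ (a : ℕ) :
    theta^[a + 1] (qExpansion 1 E₄) = 240 * theta^[a + 1] (sigmaSeries 3) := by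
  induction a with
  | zero => simp [E₄_qExpansion_eq]
  | succ a ih => 
    rw [iterate_succ_apply', ih, iterate_succ_apply' _ (a + 1)]
    simp

lemma coeff_theta_iterate_sigmaSeries (k a n : ℕ) :
    (theta^[a] (sigmaSeries k)).coeff n = (n : ℂ) ^ a * (σ k n : ℂ) := by
  induction a with
  | zero => simp [sigmaSeries]
  | succ a ih => rw [iterate_succ_apply', coeff_theta, ih]; ring

/-! ### Convolution sums -/

lemma sum_Ico_eq_coeff (n a b : ℕ) :
    ∑ m ∈ Finset.Ico 1 n, (m : ℂ) ^ a * (n - m : ℂ) ^ b * (σ 1 m : ℂ) * (σ 1 (n - m) : ℂ) =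
      ((theta^[a] (sigmaSeries 1)) * theta^[b] (sigmaSeries 1)).coeff n := by
  rw [coeff_mul, Finset.Nat.sum_antidiagonal_eq_sum_range_succ_mk, Finset.range_eq_Ico]
  simp only [coeff_theta_iterate_sigmaSeries]
  -- the end terms `m = 0` and `m = n` of the convolution vanish because `σ 1 0 = 0`
  refine Finset.sum_subset_zero_on_sdiff (fun m hm ↦ ?_) (fun m hm ↦ ?_) (fun m hm ↦ ?_)
  · simp only [Finset.mem_Ico] at *; omega
  · simp only [Finset.mem_sdiff, Finset.mem_Ico] at hm
    obtain rfl | rfl : m = 0 ∨ m = n := by omega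
    · simp
    · simp
  · simp only [Finset.mem_Ico] at hm
    rw [Nat.cast_sub hm.2.le]
    ring

/-- The coefficients come from writing `n = m + (n - m)` in `a m⁴ + b m³ n + c m² n²`; the resulting
`m² (n - m)²`, `m³ (n - m)` and `m⁴` give the coefficients of products of derivatives of
`∑ σ(n) qⁿ`. -/
lemma sum_Ico_quartic_eq (n : ℕ) (a b c : ℂ) :
    ∑ m ∈ Finset.Ico 1 n,
        (a * (m : ℂ) ^ 4 + b * (m : ℂ) ^ 3 * n + c * (m : ℂ) ^ 2 * (n : ℂ) ^ 2) * (σ 1 m : ℂ) *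
          (σ 1 (n - m) : ℂ) =
      (a + b + c) * (theta^[4] (sigmaSeries 1) * theta^[0] (sigmaSeries 1)).coeff n +
      (b + 2 * c) * (theta^[3] (sigmaSeries 1) * theta^[1] (sigmaSeries 1)).coeff n +
      c * (theta^[2] (sigmaSeries 1) * theta^[2] (sigmaSeries 1)).coeff n := by
  simp only [← sum_Ico_eq_coeff, Finset.mul_sum, ← Finset.sum_add_distrib]
  exact Finset.sum_congr rfl fun m _ ↦ by ring

/-- The four identities for `Δ`, in terms of the derivatives of `∑ σ(n) qⁿ` and `∑ σ₃(n) qⁿ`; the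
last one is multiplied by `3` so that all coefficients are integers. -/
lemma qExpansion_discriminant_relations :
    qExpansion 1 discriminant = theta^[4] (sigmaSeries 1) -
      24 * (theta^[4] (sigmaSeries 1) * theta^[0] (sigmaSeries 1) -
        16 * (theta^[3] (sigmaSeries 1) * theta^[1] (sigmaSeries 1)) +
        18 * (theta^[2] (sigmaSeries 1) * theta^[2] (sigmaSeries 1))) ∧
    qExpansion 1 discriminant = 7 * theta^[4] (sigmaSeries 1) - 6 * theta^[4] (sigmaSeries 3) -
      168 * (theta^[4] (sigmaSeries 1) * theta^[0] (sigmaSeries 1) -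
        4 * (theta^[3] (sigmaSeries 1) * theta^[1] (sigmaSeries 1))) ∧
    qExpansion 1 discriminant = theta^[4] (sigmaSeries 3) -
      168 * (3 * (theta^[2] (sigmaSeries 1) * theta^[2] (sigmaSeries 1)) -
        2 * (theta^[3] (sigmaSeries 1) * theta^[1] (sigmaSeries 1))) ∧
    3 * qExpansion 1 discriminant = 7 * theta^[4] (sigmaSeries 1) - 4 * theta^[4] (sigmaSeries 3) -
      168 * (theta^[4] (sigmaSeries 1) * theta^[0] (sigmaSeries 1) -
        8 * (theta^[3] (sigmaSeries 1) * theta^[1] (sigmaSeries 1)) +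
        6 * (theta^[2] (sigmaSeries 1) * theta^[2] (sigmaSeries 1))) := by
  have : CharZero ℂ⟦X⟧ := algebraRat.charZero _
  have hp1 := theta_iterate_E2Series 0
  have hp2 := theta_iterate_E2Series 1
  have hp3 := theta_iterate_E2Series 2
  have hp4 := theta_iterate_E2Series 3
  have hq4 := theta_iterate_E₄ 3
  simp only [zero_add, Nat.reduceAdd] at hp1 hp2 hp3 hp4 hq4
  have e0 := E2Series_eq
  have e1 := theta_E2Series
  have e2 := theta_iterate_two_E2Series
  have e3 := theta_iterate_three_E2Series
  have e4 := theta_iterate_four_E2Series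
  have f4 := theta_iterate_four_E₄
  have eD := qExpansion_discriminant_eq
  rw [← iterate_zero_apply theta (sigmaSeries 1)] at e0
  generalize theta^[0] (sigmaSeries 1) = S₀ at *
  generalize theta^[1] (sigmaSeries 1) = S₁ at *
  generalize theta^[2] (sigmaSeries 1) = S₂ at *
  generalize theta^[3] (sigmaSeries 1) = S₃ at *
  generalize theta^[4] (sigmaSeries 1) = S₄ at *
  generalize theta^[4] (sigmaSeries 3) = T at *
  generalize qExpansion 1 discriminant = d at *
  simp only [iterate_succ_apply', iterate_zero_apply] at hp1 hp2 hp3 hp4 hq4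
  rw [hp1] at e1
  rw [hp2] at e2
  rw [hp3] at e3
  rw [hp4] at e4
  rw [hq4] at f4
  generalize E2Series = P at *
  generalize qExpansion 1 E₄ = Q at *
  generalize qExpansion 1 E₆ = R at *
  have k40 : 5971968 * (S₄ * S₀) = 248832 * S₄ * (1 - P) := by
    linear_combination 248832 * S₄ * e0
  have k31 : 5971968 * (S₃ * S₁) = -20736 * S₃ * (P ^ 2 - Q) := by
    linear_combination (-20736 * S₃) * e1
  have k22 : 5971968 * (S₂ * S₂) = 2 * (P ^ 3 - 3 * P * Q + 2 * R) ^ 2 := by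
    linear_combination (-3456 * S₂ + 2 * (P ^ 3 - 3 * P * Q + 2 * R)) * e2
  -- `10 * 1728 ^ 2` is a common denominator of the expressions of all terms in `P`, `Q`, `R`
  have hM : (29859840 : ℂ⟦X⟧) ≠ 0 := by norm_num
  refine ⟨?_, ?_, ?_, ?_⟩ <;> refine mul_left_cancel₀ hM ?_
  · linear_combination 17280 * eD + (1440 - 1440 * (1 - P)) * e4 + 120 * k40
      - 1920 * k31 - 5760 * (P ^ 2 - Q) * e3 + 2160 * k22
  · linear_combination 17280 * eD + (10080 - 10080 * (1 - P)) * e4 + 864 * f4 + 840 * k40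
      - 3360 * k31 - 10080 * (P ^ 2 - Q) * e3
  · linear_combination 17280 * eD - 144 * f4 + 2520 * k22 - 1680 * k31
      - 5040 * (P ^ 2 - Q) * e3
  · linear_combination 51840 * eD + (10080 - 10080 * (1 - P)) * e4 + 576 * f4 + 840 * k40
      - 6720 * k31 - 20160 * (P ^ 2 - Q) * e3 + 5040 * k22

end RamanujanTau

theorem theorem2p5 (n : ℕ) (hn : 1 ≤ n) :
    (ramanujanTau n = (n : ℂ) ^ 4 * (σ 1 n : ℂ)
      - 24 * ∑ m ∈ Finset.Ico 1 n,
          (35 * (m : ℂ) ^ 4 - 52 * (m : ℂ) ^ 3 * (n : ℂ) + 18 * (m : ℂ) ^ 2 * (n : ℂ) ^ 2)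
            * (σ 1 m : ℂ) * (σ 1 (n - m) : ℂ)) ∧
    (ramanujanTau n = (n : ℂ) ^ 4 * (7 * (σ 1 n : ℂ) - 6 * (σ 3 n : ℂ))
      - 168 * ∑ m ∈ Finset.Ico 1 n,
          (5 * (m : ℂ) ^ 4 - 4 * (m : ℂ) ^ 3 * (n : ℂ))
            * (σ 1 m : ℂ) * (σ 1 (n - m) : ℂ)) ∧
    (ramanujanTau n = (n : ℂ) ^ 4 * (σ 3 n : ℂ)
      - 168 * ∑ m ∈ Finset.Ico 1 n,
          (5 * (m : ℂ) ^ 4 - 8 * (m : ℂ) ^ 3 * (n : ℂ) + 3 * (m : ℂ) ^ 2 * (n : ℂ) ^ 2)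
            * (σ 1 m : ℂ) * (σ 1 (n - m) : ℂ)) ∧
    (ramanujanTau n = (n : ℂ) ^ 4 / 3 * (7 * (σ 1 n : ℂ) - 4 * (σ 3 n : ℂ))
      - 56 * ∑ m ∈ Finset.Ico 1 n,
          (15 * (m : ℂ) ^ 4 - 20 * (m : ℂ) ^ 3 * (n : ℂ) + 6 * (m : ℂ) ^ 2 * (n : ℂ) ^ 2)
            * (σ 1 m : ℂ) * (σ 1 (n - m) : ℂ)) := by
  obtain ⟨h1, h2, h3, h4⟩ := RamanujanTau.qExpansion_discriminant_relations
  replace h1 := congrArg (PowerSeries.coeff n) h1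
  replace h2 := congrArg (PowerSeries.coeff n) h2
  replace h3 := congrArg (PowerSeries.coeff n) h3
  replace h4 := congrArg (PowerSeries.coeff n) h4
  simp only [map_sub, map_add, RamanujanTau.coeff_ofNat_mul,
    RamanujanTau.coeff_theta_iterate_sigmaSeries] at h1 h2 h3 h4
  have s1 := RamanujanTau.sum_Ico_quartic_eq n 35 (-52) 18
  have s2 := RamanujanTau.sum_Ico_quartic_eq n 5 (-4) 0
  have s3 := RamanujanTau.sum_Ico_quartic_eq n 5 (-8) 3
  have s4 := RamanujanTau.sum_Ico_quartic_eq n 15 (-20) 6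
  simp only [neg_mul, ← sub_eq_add_neg, zero_mul, add_zero] at s1 s2 s3 s4
  unfold ramanujanTau
  rw [s1, s2, s3, s4]
  refine ⟨?_, ?_, ?_, ?_⟩
  · linear_combination h1
  · linear_combination h2
  · linear_combination h3
  · linear_combination h4 / 3
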